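/- Let $\theta$ be an irrational real number, let $B$ be a nonzero unital $C^*$-algebra (for example the hyperfinite ${\rm II}_1$ factor), and let $u,v\in B$ be unitaries with $vu=e^{2\pi i\theta}uv$. Let $f$ be a continuous complex-valued function on the unit circle $S^1$, let $f(v)$ be given by the continuous functional calculus, and let $C^*(uf(v),1)$ be the $C^*$-subalgebra of $B$ generated by $uf(v)$ and the identity. Put $\phi(z)=e^{2\pi i\theta}z$ for $z\in S^1$, $\mathrm{Orb}(\xi)=\{\phi^n(\xi):n\in\mathbb Z\}$ for $\xi\in S^1$, and $Y=\{z\in S^1: f(z)=0\}$. Suppose that $|f|$ is not periodic, i.e. there is no $w\in S^1$, $w\neq 1$, with $|f|(wz)=|f|(z)$ for all $z\in S^1$. Then the following conditions are equivalent: (1) $C^*(uf(v),1)$ is simple (it has exactly two two-sided ideals, $0$ and itself; since the algebra is unital it is the same to consider only closed two-sided ideals); (2) $\phi^n(Y)\cap Y=\emptyset$ for all integers $n\neq 0$; (3) for each $\xi\in S^1$, $\mathrm{Orb}(\xi)\cap Y$ contains at most one point; (4) $Y_1\cap Y_2=\emptyset$, where $Y_1=\bigcup_{n\ge 0}\phi^n(Y)$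 and $Y_2=\bigcup_{k\ge 1}\phi^{-k}(Y)$. -/

import Mathlib

/-- For a unitary `v`, the inclusion of its spectrum into the unit circle. -/
noncomputable def spectrumToCircle {B : Type*} [CStarAlgebra B] (v : unitary B) :
    C(spectrum ℂ (v : B), Circle) where
  toFun z := ⟨(z : ℂ), Unitary.spectrum_subset_circle v z.2⟩
  continuous_toFun := by fun_prop

/-- `f(v)` for a unitary `v` and a continuous function `f` on the unit circle: the continuous
functional calculus of `v` applied to the restriction of `f` to the spectrum of `v`. -/
noncomputable def circleCalculus {B : Type*} [CStarAlgebra B] (v : unitary B) (f : C(Circle, ℂ)) :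
    B :=
  cfcHom (R := ℂ) (a := (v : B)) (inferInstance : IsStarNormal (v : B))
    (f.comp (spectrumToCircle v))

/-- The unital C⋆-algebra `C*(u f(v), 1)` generated by `u f(v)` and the identity. -/
noncomputable def cstarGenerated {B : Type*} [CStarAlgebra B] (u v : unitary B)
    (f : C(Circle, ℂ)) : StarSubalgebra ℂ B :=
  StarAlgebra.elemental ℂ ((u : B) * circleCalculus v f)

/-- A function `g` on the unit circle is periodic if it is invariant under multiplication by some
`w ≠ 1` of the circle (so constant functions are periodic). -/
def IsCirclePeriodic {α : Type*} (g : Circle → α) : Prop :=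
  ∃ w : Circle, w ≠ 1 ∧ ∀ z : Circle, g (w * z) = g z

/-- The rotation `z ↦ e^{2π i θ} z` of the unit circle, as a permutation, so that its integer
powers are its (forward and backward) iterates. -/
noncomputable def circleRotation (θ : ℝ) : Equiv.Perm Circle :=
  Equiv.mulLeft (Circle.exp (2 * Real.pi * θ))

/-- The two-sided orbit of `ξ` under the rotation by `θ`. -/
def rotationOrbit (θ : ℝ) (ξ : Circle) : Set Circle :=
  Set.range fun n : ℤ => (circleRotation θ ^ n) ξ

/-- The set of zeros on the unit circle. -/
def zeroSet (f : C(Circle, ℂ)) : Set Circle :=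
  {z | f z = 0}

/-!
Write `c = e^{2πiθ}`, `X = u f(v)` and `A = C*(X, 1)`. The relation `v u = c u v` gives
`u* g(v) u = (g ∘ φ)(v)` with `φ z = c z` (`star_mul_circleCalculusHom_mul`). Consequently
`X* g(v) X = (|f|² (g ∘ φ))(v)` and `X g(v) X* = ((|f|² g) ∘ φ⁻¹)(v)`: the operations `g ↦ X* g X` and
`g ↦ X g X*` act on functions as *weighted translations*. The weights vanish only at the zeros of `f`,
respectively of `f ∘ φ⁻¹`.

*No two zeros on an orbit implies simplicity.* In this case every point of the circle has a forward or
a backward orbit on which the weight does not vanish, and such an orbit is dense. Two consequences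
follow. First, a closed star algebra of functions stable under both weighted translations separates
points, because `|f|` is not periodic (`eq_of_forall_weightedTranslation_eq`); by Stone-Weierstrass
`v ∈ A`. Second, a nonzero ideal of functions stable under both weighted translations has no common
zero (`eq_zero_of_weightedTranslation_mem`), hence contains `1`. Averaging the conjugates
`v ^ j a v ^ (-j)` defines the conditional expectation of the closed span of the monomials
`u ^ k g(v)` onto the algebra generated by `v` (`exists_hasExpectation`), and it is faithful
(`eq_zero_of_hasExpectation_zero`). Since `v ∈ A`, the expectation maps an ideal of `A` into its
closure, so the closure of a nonzero ideal contains some `g(v)` with `g ≠ 0`, hence contains `1`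
(`isSimpleRing_cstarGenerated`).

*Simplicity implies no two zeros on an orbit.* The expectation followed by evaluation at a point
yields matrix coefficients along the orbit of this point, with respect to which `X` is a weighted
shift with weights the values of `f`. If `f` vanishes at `z` and at `φ ^ n z` with `n > 0`, the shift
splits off a block of size `n`, which gives a unital representation of `A` by `n × n` matrices
(`exists_algHom_matrix`). If `A` is simple this representation is injective, so `X* X = |f|²(v)` is
algebraic over `ℂ`; then `|f|` takes finitely many values on a connected space and is constant,
contrary to the assumption that it is not periodic (`ne_zero_of_isSimpleRing`).

The remaining conditions are restatements of the absence of two zeros on one orbit.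
-/

open Topology Filter

/-! ### Minimality of the irrational rotation and weighted translations -/

theorem denseRange_circleExp_pow {θ : ℝ} (hθ : Irrational θ) :
    DenseRange fun n : ℕ => Circle.exp (2 * Real.pi * θ) ^ n := by
  rw [← denseRange_zpow_iff_pow]
  have h1 : DenseRange fun n : ℤ => n • ((θ : ℝ) : AddCircle (1 : ℝ)) :=
    AddCircle.denseRange_zsmul_coe_iff.2 (by simpa using hθ)
  have h2 : DenseRange (AddCircle.toCircle : AddCircle (1 : ℝ) → Circle) := by
    have h := (AddCircle.homeomorphCircle (T := 1) one_ne_zero).surjective.denseRange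
    rwa [funext (AddCircle.homeomorphCircle_apply one_ne_zero)] at h
  have h3 := h2.comp h1 AddCircle.continuous_toCircle
  simpa [Function.comp_def, AddCircle.toCircle_zsmul, AddCircle.toCircle_apply_mk] using h3

theorem denseRange_pow_mul {d : Circle} (hd : DenseRange fun n : ℕ => d ^ n) (z : Circle) :
    DenseRange fun n : ℕ => d ^ n * z :=
  (Homeomorph.mulRight z).surjective.denseRange.comp hd (Homeomorph.mulRight z).continuous

theorem denseRange_inv_pow {d : Circle} (hd : DenseRange fun n : ℕ => d ^ n) :
    DenseRange fun n : ℕ => d⁻¹ ^ n := by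
  have h := inv_surjective.denseRange.comp hd (continuous_inv (G := Circle))
  simpa [Function.comp_def] using h

theorem zpow_ne_one_of_denseRange_pow {d : Circle} (hd : DenseRange fun n : ℕ => d ^ n) {n : ℤ}
    (hn : n ≠ 0) : d ^ n ≠ 1 := by
  intro h
  -- A root of unity has a finite orbit, which cannot be dense in the circle.
  have hfin : (Set.range fun n : ℕ => d ^ n).Finite := by
    have : IsOfFinOrder d := isOfFinOrder_iff_zpow_eq_one.2 ⟨n, hn, h⟩
    have h := this.finite_powers
    rwa [Submonoid.coe_powers] at h
  have huniv : (Set.univ : Set Circle).Finite := by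
    rw [← hd.closure_range, hfin.isClosed.closure_eq]; exact hfin
  have : Nontrivial Circle := by
    refine ⟨Circle.exp Real.pi, 1, fun h => ?_⟩
    have := congrArg (Subtype.val) h
    norm_num [Circle.coe_exp, Complex.exp_pi_mul_I] at this
  have : Infinite Circle := PreconnectedSpace.infinite
  exact Set.infinite_univ huniv

/-- Translation of functions on the circle: `circleTranslate d g z = g (d * z)`. -/
noncomputable def circleTranslate (d : Circle) : C(Circle, ℂ) →⋆ₐ[ℂ] C(Circle, ℂ) :=
  ContinuousMap.compStarAlgHom' ℂ ℂ ⟨(d * ·), by fun_prop⟩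

@[simp]
theorem circleTranslate_apply (d : Circle) (g : C(Circle, ℂ)) (z : Circle) :
    circleTranslate d g z = g (d * z) := rfl

@[simp]
theorem circleTranslate_one (g : C(Circle, ℂ)) : circleTranslate 1 g = g := by ext; simp

theorem circleTranslate_circleTranslate (c d : Circle) (g : C(Circle, ℂ)) :
    circleTranslate c (circleTranslate d g) = circleTranslate (d * c) g := by ext; simp [mul_assoc]

theorem continuous_circleTranslate (d : Circle) : Continuous (circleTranslate d) :=
  ContinuousMap.continuous_precomp _

/-- A proper ideal is contained in a maximal one, which is the ideal of functions vanishing at some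
point. -/
theorem ideal_eq_top_of_forall_exists_ne_zero (I : Ideal C(Circle, ℂ))
    (h : ∀ z, ∃ g ∈ I, g z ≠ 0) : I = ⊤ := by
  by_contra hI
  obtain ⟨M, hM, hIM⟩ := Ideal.exists_le_maximal I hI
  obtain ⟨x, hx⟩ := ContinuousMap.setOfIdeal_eq_compl_singleton (𝕜 := ℂ) M
  obtain ⟨g, hg, hgx⟩ := h x
  have : x ∈ ContinuousMap.setOfIdeal M := ContinuousMap.mem_setOfIdeal.2 ⟨g, hIM hg, hgx⟩
  simp [hx] at this

/-- The Stone-Weierstrass theorem for closed star subalgebras of `C(S¹)`. -/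
theorem starSubalgebra_eq_top_of_separates (D : StarSubalgebra ℂ C(Circle, ℂ))
    (hD : IsClosed (D : Set C(Circle, ℂ))) (h : ∀ z w : Circle, (∀ g ∈ D, g z = g w) → z = w) :
    D = ⊤ := by
  have hsep : D.SeparatesPoints := by
    intro z w hzw
    by_contra! hcon
    exact hzw (h z w fun g hg => hcon g ⟨g, hg, rfl⟩)
  have h' := ContinuousMap.starSubalgebra_topologicalClosure_eq_top_of_separatesPoints D hsep
  rw [eq_top_iff, ← h']
  exact StarSubalgebra.topologicalClosure_minimal le_rfl hD

section WeightedTranslation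

variable {d : Circle} (hd : DenseRange fun n : ℕ => d ^ n) {m : C(Circle, ℂ)}
include hd

/-- Suppose that `D` does not separate `z₁` from `z₂`. As long as the weight does not vanish it can be
cancelled, so the iterates of `z₁` and `z₂` are not separated either. If this holds along the whole
forward orbit, then by density `m` is invariant under `z₂ / z₁`. -/
theorem eq_of_forall_weightedTranslation_eq (hm : ¬ IsCirclePeriodic m)
    {D : Set C(Circle, ℂ)} (h1 : 1 ∈ D) (hD : ∀ g ∈ D, m * circleTranslate d g ∈ D) {z₁ z₂ : Circle}
    (hz : ∀ n : ℕ, m (d ^ n * z₁) ≠ 0) (h : ∀ g ∈ D, g z₁ = g z₂) : z₁ = z₂ := by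
  have hmD : m ∈ D := by simpa using hD 1 h1
  have key : ∀ n : ℕ, ∀ g ∈ D, g (d ^ n * z₁) = g (d ^ n * z₂) := by
    intro n
    induction n with
    | zero => simpa using h
    | succ n ih =>
      intro g hg
      have h2 := ih _ (hD g hg)
      have h3 := ih m hmD
      simp only [ContinuousMap.mul_apply, circleTranslate_apply] at h2
      rw [← h3] at h2
      simpa [pow_succ', mul_assoc] using mul_left_cancel₀ (hz n) h2
  have hall : ∀ w : Circle, m (w * z₁) = m (w * z₂) := by
    have := hd.equalizer (g := fun w : Circle => m (w * z₁)) (h := fun w : Circle => m (w * z₂))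
      (by fun_prop) (by fun_prop) (funext fun n => key n m hmD)
    exact fun w => congrFun this w
  by_contra hne
  refine hm ⟨z₂ * z₁⁻¹, fun h => hne (mul_inv_eq_one.1 h).symm, fun z => ?_⟩
  have := hall (z * z₁⁻¹)
  simp only [inv_mul_cancel_right] at this
  rw [this]
  congr 1
  rw [mul_assoc, mul_comm, mul_comm z₁⁻¹]

/-- A common zero of a family of functions stays a common zero along its forward orbit as long as
the weight does not vanish there; by minimality of the rotation the whole family vanishes. -/
theorem eq_zero_of_weightedTranslation_mem {I : Set C(Circle, ℂ)}
    (hI : ∀ g ∈ I, m * circleTranslate d g ∈ I) {z : Circle}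
    (hz : ∀ n : ℕ, m (d ^ n * z) ≠ 0) (h : ∀ g ∈ I, g z = 0) : ∀ g ∈ I, g = 0 := by
  have key : ∀ n : ℕ, ∀ g ∈ I, g (d ^ n * z) = 0 := by
    intro n
    induction n with
    | zero => simpa using h
    | succ n ih =>
      intro g hg
      have h2 := ih _ (hI g hg)
      simp only [ContinuousMap.mul_apply, circleTranslate_apply, mul_eq_zero, hz n, false_or] at h2
      simpa [pow_succ', mul_assoc] using h2
  intro g hg
  have := (denseRange_pow_mul hd z).equalizer (g := g) (h := fun _ => 0)
    (by fun_prop) (by fun_prop) (funext fun n => key n g hg)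
  ext w
  simpa using congrFun this w

end WeightedTranslation

/-- Finitely many iterates of the rotation bring every point of the circle close to `1`. -/
theorem exists_forall_exists_lt_pow_mul_mem {d : Circle} (hd : DenseRange fun n : ℕ => d ^ n)
    {U : Set Circle} (hU : U ∈ 𝓝 1) : ∃ N : ℕ, ∀ z : Circle, ∃ i < N, d ^ i * z ∈ U := by
  have hopen : ∀ i : ℕ, IsOpen {z : Circle | d ^ i * z ∈ interior U} := fun i =>
    isOpen_interior.preimage (by fun_prop)
  have hcover : (Set.univ : Set Circle) ⊆ ⋃ i : ℕ, {z : Circle | d ^ i * z ∈ interior U} := by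
    intro z _
    obtain ⟨n, hn⟩ := (denseRange_pow_mul hd z).exists_mem_open isOpen_interior
      ⟨1, mem_interior_iff_mem_nhds.2 hU⟩
    exact Set.mem_iUnion.2 ⟨n, hn⟩
  obtain ⟨t, ht⟩ := isCompact_univ.elim_finite_subcover _ hopen hcover
  refine ⟨t.sup id + 1, fun z => ?_⟩
  obtain ⟨i, hi, hz⟩ := Set.mem_iUnion₂.1 (ht (Set.mem_univ z))
  exact ⟨i, Nat.lt_succ_of_le (Finset.le_sup (f := id) hi), interior_subset hz⟩

/-! ### Functional calculus of a rotated unitary -/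

section Calculus

variable {B : Type*} [CStarAlgebra B]

/-- The calculus `f ↦ f(v)` of a unitary `v` as a star homomorphism on `C(S¹)`. -/
noncomputable def circleCalculusHom (v : unitary B) : C(Circle, ℂ) →⋆ₐ[ℂ] B :=
  (cfcHom (R := ℂ) (a := (v : B)) (inferInstance : IsStarNormal (v : B))).comp
    (ContinuousMap.compStarAlgHom' ℂ ℂ (spectrumToCircle v))

theorem circleCalculusHom_apply (v : unitary B) (g : C(Circle, ℂ)) :
    circleCalculusHom v g = circleCalculus v g := rfl

theorem continuous_circleCalculusHom (v : unitary B) : Continuous (circleCalculusHom v) :=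
  (cfcHom_continuous _).comp (ContinuousMap.continuous_precomp _)

/-- The inclusion of the circle into the complex plane. -/
def circleCoord : C(Circle, ℂ) := ⟨fun z => z, by fun_prop⟩

@[simp]
theorem circleCoord_apply (z : Circle) : circleCoord z = z := rfl

@[simp]
theorem circleCalculusHom_coord (v : unitary B) : circleCalculusHom v circleCoord = v :=
  cfcHom_id (R := ℂ) (inferInstance : IsStarNormal (v : B))

/-- The coordinate function generates `C(S¹)` as a closed star algebra. -/
theorem starAlgHom_circle_ext {S T : C(Circle, ℂ) →⋆ₐ[ℂ] B} (hS : Continuous S)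
    (hT : Continuous T) (h : S circleCoord = T circleCoord) : S = T := by
  have htop : StarAlgHom.equalizer S T = ⊤ := by
    refine starSubalgebra_eq_top_of_separates _ (isClosed_eq hS hT) fun z w hzw => ?_
    exact Circle.ext (hzw circleCoord h)
  ext1 g
  have : g ∈ StarAlgHom.equalizer S T := htop ▸ StarSubalgebra.mem_top
  exact this

theorem circleCalculusHom_mul_comm (v : unitary B) (g h : C(Circle, ℂ)) :
    circleCalculusHom v g * circleCalculusHom v h =
      circleCalculusHom v h * circleCalculusHom v g := by
  rw [← map_mul, mul_comm, map_mul]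

/-- Covariance of the calculus: if `w` rotates `v` by `d`, conjugation by `w` translates
functions by `d`. -/
theorem star_mul_circleCalculusHom_mul {v w : unitary B} {d : Circle}
    (h : (v : B) * w = (d : ℂ) • ((w : B) * v)) (g : C(Circle, ℂ)) :
    (star w : B) * circleCalculusHom v g * w = circleCalculusHom v (circleTranslate d g) := by
  have hcoord : circleTranslate d circleCoord = (d : ℂ) • circleCoord := by ext; simp
  have key := starAlgHom_circle_ext
    (S := (Unitary.conjStarAlgAut ℂ B (star w) : B →⋆ₐ[ℂ] B).comp (circleCalculusHom v))
    (T := (circleCalculusHom v).comp (circleTranslate d))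
    (by
      have := continuous_circleCalculusHom v
      simp only [StarAlgHom.coe_comp, StarAlgHom.coe_coe]
      refine Continuous.comp ?_ this
      have : (⇑(Unitary.conjStarAlgAut ℂ B (star w))) = fun x : B => (star w : B) * x * w := by
        ext x; simp
      rw [this]; fun_prop)
    ((continuous_circleCalculusHom v).comp (continuous_circleTranslate d))
    (by
      simp only [StarAlgHom.comp_apply, StarAlgHom.coe_coe, hcoord, map_smul,
        circleCalculusHom_coord, Unitary.conjStarAlgAut_star_apply]
      rw [mul_assoc, h, mul_smul_comm, ← mul_assoc, Unitary.coe_star_mul_self, one_mul])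
  simpa using DFunLike.congr_fun key g

theorem circleCalculusHom_mul_unitary {v w : unitary B} {d : Circle}
    (h : (v : B) * w = (d : ℂ) • ((w : B) * v)) (g : C(Circle, ℂ)) :
    circleCalculusHom v g * w = w * circleCalculusHom v (circleTranslate d g) := by
  rw [← star_mul_circleCalculusHom_mul h, ← mul_assoc, ← mul_assoc,
    Unitary.mul_star_self_of_mem w.2, one_mul]

theorem rotation_star {v w : unitary B} {d : Circle}
    (h : (v : B) * w = (d : ℂ) • ((w : B) * v)) :
    (v : B) * (star w : unitary B) = ((d⁻¹ : Circle) : ℂ) • (((star w : unitary B) : B) * v) := by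
  have h1 : (v : B) = (d : ℂ) • (w * v * star w : B) := by
    rw [← smul_mul_assoc, ← h, mul_assoc, Unitary.coe_mul_star_self, mul_one]
  have h2 : ((star w : unitary B) : B) * v = (d : ℂ) • (v * star w : B) := by
    nth_rw 1 [h1]
    rw [mul_smul_comm, Unitary.coe_star, ← mul_assoc, ← mul_assoc, Unitary.coe_star_mul_self,
      one_mul]
  rw [h2, smul_smul, ← Circle.coe_mul, inv_mul_cancel, Circle.coe_one, one_smul, Unitary.coe_star]

theorem rotation_mul {v w w' : unitary B} {d d' : Circle}
    (h : (v : B) * w = (d : ℂ) • ((w : B) * v)) (h' : (v : B) * w' = (d' : ℂ) • ((w' : B) * v)) :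
    (v : B) * (w * w' : unitary B) = ((d * d' : Circle) : ℂ) • (((w * w' : unitary B) : B) * v) := by
  rw [Submonoid.coe_mul, ← mul_assoc, h, smul_mul_assoc, mul_assoc, h', mul_smul_comm, smul_smul,
    Circle.coe_mul, mul_assoc]

theorem rotation_zpow {v w : unitary B} {d : Circle}
    (h : (v : B) * w = (d : ℂ) • ((w : B) * v)) (k : ℤ) :
    (v : B) * (w ^ k : unitary B) = ((d ^ k : Circle) : ℂ) • (((w ^ k : unitary B) : B) * v) := by
  induction k using Int.induction_on with
  | zero => simp
  | succ n ih => rw [zpow_add_one, zpow_add_one]; exact rotation_mul ih h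
  | pred n ih => rw [zpow_sub_one, zpow_sub_one]; exact rotation_mul ih (rotation_star h)

/-- The kernel of the calculus is a proper ideal invariant under an irrational rotation, hence zero;
equivalently, the spectrum of `v` is the whole circle. -/
theorem circleCalculusHom_injective [Nontrivial B] {u v : unitary B} {c : Circle}
    (hc : DenseRange fun n : ℕ => c ^ n) (h : (v : B) * u = (c : ℂ) • ((u : B) * v)) :
    Function.Injective (circleCalculusHom v) := by
  rw [injective_iff_map_eq_zero]
  by_contra! hcon
  obtain ⟨g, hg, hg0⟩ := hcon
  let I : Ideal C(Circle, ℂ) := RingHom.ker (circleCalculusHom v)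
  have hI : ∀ f ∈ I, (1 : C(Circle, ℂ)) * circleTranslate c f ∈ I := by
    intro f hf
    have hf : circleCalculusHom v f = 0 := hf
    change circleCalculusHom v _ = 0
    rw [one_mul, ← star_mul_circleCalculusHom_mul h, hf]
    simp
  have htop : I = ⊤ := by
    refine ideal_eq_top_of_forall_exists_ne_zero I fun z => ?_
    by_contra! hz
    exact hg0 (eq_zero_of_weightedTranslation_mem hc (I := I) hI (z := z) (by simp) hz g hg)
  have h1 : (1 : C(Circle, ℂ)) ∈ I := htop ▸ Submodule.mem_top
  have h1 : circleCalculusHom v 1 = 0 := h1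
  simp at h1

end Calculus

/-! ### The conditional expectation onto the algebra generated by `v` -/

section Expectation

variable {B : Type*} [CStarAlgebra B]

/-- The closed linear span of the monomials `u ^ k g(v)`, with `k` an integer and `g` a continuous
function on the circle. -/
noncomputable def rotationSpan (u v : unitary B) : Submodule ℂ B :=
  (Submodule.span ℂ (Set.range fun p : ℤ × C(Circle, ℂ) =>
    ((u ^ p.1 : unitary B) : B) * circleCalculusHom v p.2)).topologicalClosure

theorem rotationSpan_le {u v : unitary B} {N : Submodule ℂ B} (hN : IsClosed (N : Set B))
    (h : ∀ (k : ℤ) g, ((u ^ k : unitary B) : B) * circleCalculusHom v g ∈ N) :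
    rotationSpan u v ≤ N := by
  refine Submodule.topologicalClosure_minimal _ (Submodule.span_le.2 ?_) hN
  rintro _ ⟨p, rfl⟩
  exact h p.1 p.2

theorem zpow_mul_mem_rotationSpan (u v : unitary B) (k : ℤ) (g : C(Circle, ℂ)) :
    ((u ^ k : unitary B) : B) * circleCalculusHom v g ∈ rotationSpan u v :=
  Submodule.le_topologicalClosure _ (Submodule.subset_span ⟨(k, g), rfl⟩)

theorem map_mem_rotationSpan {u v : unitary B} (L : B →L[ℂ] B)
    (h : ∀ (k : ℤ) g, L (((u ^ k : unitary B) : B) * circleCalculusHom v g) ∈ rotationSpan u v)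
    {b : B} (hb : b ∈ rotationSpan u v) : L b ∈ rotationSpan u v := by
  have hcl : IsClosed (rotationSpan u v : Set B) := Submodule.isClosed_topologicalClosure _
  exact rotationSpan_le (N := (rotationSpan u v).comap (L : B →ₗ[ℂ] B))
    (hcl.preimage L.continuous) h hb

theorem unitary_zpow_mul_mem_rotationSpan {u v : unitary B} (k : ℤ) {b : B}
    (hb : b ∈ rotationSpan u v) : ((u ^ k : unitary B) : B) * b ∈ rotationSpan u v := by
  refine map_mem_rotationSpan (ContinuousLinearMap.mul ℂ B ((u ^ k : unitary B) : B))
    (fun l g => ?_) hb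
  rw [ContinuousLinearMap.mul_apply', ← mul_assoc, ← Submonoid.coe_mul, ← zpow_add]
  exact zpow_mul_mem_rotationSpan u v _ g

theorem circleCalculusHom_mul_mem_rotationSpan {u v : unitary B} {c : Circle}
    (h : (v : B) * u = (c : ℂ) • ((u : B) * v)) (f : C(Circle, ℂ)) {b : B}
    (hb : b ∈ rotationSpan u v) : circleCalculusHom v f * b ∈ rotationSpan u v := by
  refine map_mem_rotationSpan (ContinuousLinearMap.mul ℂ B (circleCalculusHom v f))
    (fun l g => ?_) hb
  rw [ContinuousLinearMap.mul_apply', ← mul_assoc,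
    circleCalculusHom_mul_unitary (rotation_zpow h l), mul_assoc, ← map_mul]
  exact zpow_mul_mem_rotationSpan u v _ _

/-- The algebra generated by `u f(v)` acts on `rotationSpan u v` by left multiplication. -/
theorem mul_mem_rotationSpan {u v : unitary B} {c : Circle}
    (h : (v : B) * u = (c : ℂ) • ((u : B) * v)) {f : C(Circle, ℂ)} {a : B}
    (ha : a ∈ cstarGenerated u v f) {b : B} (hb : b ∈ rotationSpan u v) :
    a * b ∈ rotationSpan u v := by
  revert b
  induction ha using StarAlgebra.elemental.induction_on with
  | self =>
    intro b hb
    rw [mul_assoc]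
    rw [← circleCalculusHom_apply]
    simpa using unitary_zpow_mul_mem_rotationSpan 1 (circleCalculusHom_mul_mem_rotationSpan h f hb)
  | star_self =>
    intro b hb
    rw [star_mul, mul_assoc, ← circleCalculusHom_apply, ← map_star]
    refine circleCalculusHom_mul_mem_rotationSpan h _ ?_
    have := unitary_zpow_mul_mem_rotationSpan (-1) hb
    rwa [zpow_neg_one, ← Unitary.star_eq_inv, Unitary.coe_star] at this
  | algebraMap r =>
    intro b hb
    rw [← Algebra.smul_def]
    exact Submodule.smul_mem _ _ hb
  | add x _ y _ hx hy =>
    intro b hb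
    rw [add_mul]
    exact add_mem (hx hb) (hy hb)
  | mul x _ y _ hx hy =>
    intro b hb
    rw [mul_assoc]
    exact hx (hy hb)
  | closure s _ hs x hx =>
    intro b hb
    have hcl : IsClosed (rotationSpan u v : Set B) := Submodule.isClosed_topologicalClosure _
    exact closure_minimal (t := (· * b) ⁻¹' (rotationSpan u v : Set B))
      (fun y hy => hs y hy hb) (hcl.preimage (continuous_mul_const b)) hx

theorem one_mem_rotationSpan (u v : unitary B) : (1 : B) ∈ rotationSpan u v := by
  simpa using zpow_mul_mem_rotationSpan u v 0 1

theorem cstarGenerated_le_rotationSpan {u v : unitary B} {c : Circle}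
    (h : (v : B) * u = (c : ℂ) • ((u : B) * v)) {f : C(Circle, ℂ)} {a : B}
    (ha : a ∈ cstarGenerated u v f) : a ∈ rotationSpan u v := by
  simpa using mul_mem_rotationSpan h ha (one_mem_rotationSpan u v)

theorem unitary_pow_mul_eq {v w : unitary B} {d : Circle}
    (h : (v : B) * w = (d : ℂ) • ((w : B) * v)) (j : ℕ) :
    ((v ^ j : unitary B) : B) * w = ((d ^ j : Circle) : ℂ) • ((w : B) * (v ^ j : unitary B)) := by
  induction j with
  | zero => simp
  | succ j ih =>
    rw [pow_succ v, Submonoid.coe_mul, mul_assoc, h, mul_smul_comm, ← mul_assoc, ih,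
      smul_mul_assoc, smul_smul, mul_assoc, ← Circle.coe_mul, ← pow_succ']

theorem circleCalculusHom_mul_pow_comm (v : unitary B) (j : ℕ) (g : C(Circle, ℂ)) :
    ((v ^ j : unitary B) : B) * circleCalculusHom v g =
      circleCalculusHom v g * (v ^ j : unitary B) := by
  have : ((v ^ j : unitary B) : B) = circleCalculusHom v (circleCoord ^ j) := by
    simp
  rw [this, circleCalculusHom_mul_comm]

theorem conj_pow_mul {v w : unitary B} {d : Circle}
    (h : (v : B) * w = (d : ℂ) • ((w : B) * v)) (j : ℕ) (b : B) :
    Unitary.conjStarAlgAut ℂ B (v ^ j) (w * b) =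
      ((d ^ j : Circle) : ℂ) • (w * Unitary.conjStarAlgAut ℂ B (v ^ j) b) := by
  simp only [Unitary.conjStarAlgAut_apply]
  rw [← mul_assoc, unitary_pow_mul_eq h, smul_mul_assoc, smul_mul_assoc]
  simp only [mul_assoc]

theorem conj_pow_circleCalculusHom (v : unitary B) (j : ℕ) (g : C(Circle, ℂ)) :
    Unitary.conjStarAlgAut ℂ B (v ^ j) (circleCalculusHom v g) = circleCalculusHom v g := by
  rw [Unitary.conjStarAlgAut_apply, circleCalculusHom_mul_pow_comm, mul_assoc]
  rw [Unitary.mul_star_self_of_mem (v ^ j).2, mul_one]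

theorem conj_pow_monomial {u v : unitary B} {c : Circle}
    (h : (v : B) * u = (c : ℂ) • ((u : B) * v)) (j : ℕ) (k : ℤ) (g : C(Circle, ℂ)) :
    Unitary.conjStarAlgAut ℂ B (v ^ j) (((u ^ k : unitary B) : B) * circleCalculusHom v g) =
      (((c ^ k) ^ j : Circle) : ℂ) • (((u ^ k : unitary B) : B) * circleCalculusHom v g) := by
  rw [conj_pow_mul (rotation_zpow h k), conj_pow_circleCalculusHom]

theorem norm_conjStarAlgAut (w : unitary B) (b : B) :
    ‖Unitary.conjStarAlgAut ℂ B w b‖ = ‖b‖ :=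
  StarAlgEquiv.norm_map _ b

/-- The average of the conjugates `v ^ j b v ^ (-j)` over `0 ≤ j < n`. -/
noncomputable def conjAverage (v : unitary B) (n : ℕ) : B →ₗ[ℂ] B :=
  (n : ℂ)⁻¹ • ∑ j ∈ Finset.range n,
    (Unitary.conjStarAlgAut ℂ B (v ^ j)).toAlgEquiv.toLinearMap

theorem conjAverage_apply (v : unitary B) (n : ℕ) (b : B) :
    conjAverage v n b =
      (n : ℂ)⁻¹ • ∑ j ∈ Finset.range n, Unitary.conjStarAlgAut ℂ B (v ^ j) b := by
  simp [conjAverage]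

theorem norm_conjAverage_le (v : unitary B) (n : ℕ) (b : B) : ‖conjAverage v n b‖ ≤ ‖b‖ := by
  rcases Nat.eq_zero_or_pos n with rfl | hn
  · simp [conjAverage_apply]
  have hn' : (0 : ℝ) < n := by exact_mod_cast hn
  rw [conjAverage_apply, norm_smul, norm_inv, Complex.norm_natCast, inv_mul_le_iff₀ hn']
  refine (norm_sum_le _ _).trans ?_
  simp only [norm_conjStarAlgAut]
  simp

theorem conjAverage_circleCalculusHom_mul (v : unitary B) (n : ℕ) (g : C(Circle, ℂ)) (b : B) :
    conjAverage v n (circleCalculusHom v g * b) = circleCalculusHom v g * conjAverage v n b := by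
  simp only [conjAverage_apply, map_mul, conj_pow_circleCalculusHom, ← Finset.mul_sum,
    mul_smul_comm]

/-- The function `g` represents the conditional expectation of `b` onto the algebra generated by
`v`: the averages of the conjugates of `b` by powers of `v` converge to `g(v)`. -/
def HasExpectation (v : unitary B) (b : B) (g : C(Circle, ℂ)) : Prop :=
  Tendsto (fun n => conjAverage v n b) atTop (𝓝 (circleCalculusHom v g))

/-- The geometric sums of `d ≠ 1` are bounded, so their averages tend to zero. -/
theorem tendsto_average_pow_circle {d : Circle} (hd : d ≠ 1) :
    Tendsto (fun n : ℕ => (n : ℂ)⁻¹ * ∑ j ∈ Finset.range n, ((d ^ j : Circle) : ℂ)) atTop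
      (𝓝 0) := by
  have hd' : (d : ℂ) ≠ 1 := fun h => hd (Circle.ext h)
  have hbound : ∀ n : ℕ, ‖(n : ℂ)⁻¹ * ∑ j ∈ Finset.range n, ((d ^ j : Circle) : ℂ)‖ ≤
      (2 / ‖(d : ℂ) - 1‖) * (n : ℝ)⁻¹ := by
    intro n
    rw [norm_mul, norm_inv, Complex.norm_natCast, mul_comm]
    refine mul_le_mul_of_nonneg_right ?_ (by positivity)
    simp only [Circle.coe_pow]
    rw [geom_sum_eq hd', norm_div]
    refine div_le_div_of_nonneg_right ?_ (norm_nonneg _)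
    refine (norm_sub_le _ _).trans ?_
    rw [norm_pow, Circle.norm_coe]
    norm_num
  refine squeeze_zero_norm hbound ?_
  simpa using (tendsto_inv_atTop_nhds_zero_nat (𝕜 := ℝ)).const_mul (2 / ‖(d : ℂ) - 1‖)

theorem hasExpectation_monomial {u v : unitary B} {c : Circle}
    (hc : DenseRange fun n : ℕ => c ^ n) (h : (v : B) * u = (c : ℂ) • ((u : B) * v)) (k : ℤ)
    (g : C(Circle, ℂ)) :
    HasExpectation v (((u ^ k : unitary B) : B) * circleCalculusHom v g)
      (if k = 0 then g else 0) := by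
  unfold HasExpectation
  simp only [conjAverage_apply, conj_pow_monomial h, ← Finset.sum_smul, smul_smul]
  split_ifs with hk
  · subst hk
    refine tendsto_nhds_of_eventually_eq ?_
    filter_upwards [eventually_ne_atTop 0] with n hn
    simp [hn]
  · simpa using (tendsto_average_pow_circle (zpow_ne_one_of_denseRange_pow hc hk)).smul_const
      (((u ^ k : unitary B) : B) * circleCalculusHom v g)

namespace HasExpectation

variable {v : unitary B} {a b : B} {g h : C(Circle, ℂ)}

theorem add (ha : HasExpectation v a g) (hb : HasExpectation v b h) :
    HasExpectation v (a + b) (g + h) := by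
  simpa [HasExpectation] using Tendsto.add ha hb

theorem smul (z : ℂ) (ha : HasExpectation v a g) : HasExpectation v (z • a) (z • g) := by
  simpa [HasExpectation] using Tendsto.const_smul ha z

theorem sub (ha : HasExpectation v a g) (hb : HasExpectation v b h) :
    HasExpectation v (a - b) (g - h) := by
  simpa [HasExpectation] using Tendsto.sub ha hb

theorem circleCalculusHom_mul (f : C(Circle, ℂ)) (ha : HasExpectation v a g) :
    HasExpectation v (circleCalculusHom v f * a) (f * g) := by
  simpa [HasExpectation, conjAverage_circleCalculusHom_mul] using
    Tendsto.const_mul (circleCalculusHom v f) ha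

theorem norm_le (ha : HasExpectation v a g) : ‖circleCalculusHom v g‖ ≤ ‖a‖ :=
  le_of_tendsto (Tendsto.norm ha) (Eventually.of_forall fun n => norm_conjAverage_le v n a)

end HasExpectation

/-- Every element of `rotationSpan u v` has an expectation: this holds for the monomials, and
passes to limits because the averages are contractions and the calculus is isometric. -/
theorem exists_hasExpectation [Nontrivial B] {u v : unitary B} {c : Circle}
    (hc : DenseRange fun n : ℕ => c ^ n) (h : (v : B) * u = (c : ℂ) • ((u : B) * v)) {b : B}
    (hb : b ∈ rotationSpan u v) : ∃ g, HasExpectation v b g := by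
  let N : Submodule ℂ B :=
    { carrier := {b | ∃ g, HasExpectation v b g}
      zero_mem' := ⟨0, by simp [HasExpectation]⟩
      add_mem' := fun ⟨g, hg⟩ ⟨g', hg'⟩ => ⟨g + g', hg.add hg'⟩
      smul_mem' := fun z _ ⟨g, hg⟩ => ⟨z • g, hg.smul z⟩ }
  refine rotationSpan_le (N := N) ?_ (fun k g => ⟨_, hasExpectation_monomial hc h k g⟩) hb
  refine isClosed_of_closure_subset fun b hb => ?_
  obtain ⟨x, hxN, hx⟩ := mem_closure_iff_seq_limit.1 hb
  choose g hg using hxN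
  have hcauchy : CauchySeq fun k => circleCalculusHom v (g k) := by
    refine Metric.cauchySeq_iff.2 fun ε hε => ?_
    obtain ⟨K, hK⟩ := Metric.cauchySeq_iff.1 hx.cauchySeq ε hε
    refine ⟨K, fun m hm n hn => lt_of_le_of_lt ?_ (hK m hm n hn)⟩
    rw [dist_eq_norm, dist_eq_norm, ← map_sub]
    exact ((hg m).sub (hg n)).norm_le
  obtain ⟨y, hy⟩ := cauchySeq_tendsto_of_complete hcauchy
  have hcl : IsClosed (Set.range (circleCalculusHom v)) :=
    (NonUnitalStarAlgHom.isometry (circleCalculusHom v)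
      (circleCalculusHom_injective hc h)).isClosedEmbedding.isClosed_range
  obtain ⟨g₀, rfl⟩ := hcl.mem_of_tendsto hy (Eventually.of_forall fun k => ⟨g k, rfl⟩)
  refine ⟨g₀, TendstoUniformly.tendsto_of_eventually_tendsto
    (F := fun k n => conjAverage v n (x k)) ?_ (Eventually.of_forall hg) hy⟩
  refine Metric.tendstoUniformly_iff.2 fun ε hε => ?_
  filter_upwards [Metric.tendsto_nhds.1 hx ε hε] with k hk n
  refine lt_of_le_of_lt ?_ hk
  rw [dist_comm, dist_eq_norm, dist_eq_norm, ← map_sub]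
  exact norm_conjAverage_le v n _

/-- Conjugation of `b` by `v ^ j` is close to `b` whenever `c ^ j` is close to `1`. -/
theorem tendsto_conj_pow {u v : unitary B} {c : Circle}
    (h : (v : B) * u = (c : ℂ) • ((u : B) * v)) {b : B} (hb : b ∈ rotationSpan u v) :
    Tendsto (fun j : ℕ => Unitary.conjStarAlgAut ℂ B (v ^ j) b)
      (comap (fun j : ℕ => c ^ j) (𝓝 1)) (𝓝 b) := by
  let N : Submodule ℂ B :=
    { carrier := {b | Tendsto (fun j : ℕ => Unitary.conjStarAlgAut ℂ B (v ^ j) b)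
        (comap (fun j : ℕ => c ^ j) (𝓝 1)) (𝓝 b)}
      zero_mem' := by simpa only [Set.mem_ofPred_eq, map_zero] using tendsto_const_nhds
      add_mem' := fun ha hb => by simpa using Tendsto.add ha hb
      smul_mem' := fun z _ ha => by
        simpa only [Set.mem_ofPred_eq, map_smul] using Tendsto.const_smul ha z }
  refine rotationSpan_le (N := N) ?_ (fun k g => ?_) hb
  · refine isClosed_of_closure_subset fun b hb => ?_
    obtain ⟨x, hxN, hx⟩ := mem_closure_iff_seq_limit.1 hb
    refine TendstoUniformly.tendsto_of_eventually_tendsto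
      (F := fun k j => Unitary.conjStarAlgAut ℂ B (v ^ j) (x k)) ?_ (Eventually.of_forall hxN) hx
    refine Metric.tendstoUniformly_iff.2 fun ε hε => ?_
    filter_upwards [Metric.tendsto_nhds.1 hx ε hε] with k hk n
    rw [dist_comm, dist_eq_norm, ← map_sub, norm_conjStarAlgAut, ← dist_eq_norm]
    exact hk
  · change Tendsto _ _ _
    simp only [conj_pow_monomial h]
    have h1 : Tendsto (fun j : ℕ => (((c ^ k) ^ j : Circle) : ℂ))
        (comap (fun j : ℕ => c ^ j) (𝓝 1)) (𝓝 1) := by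
      have hcont : Continuous fun z : Circle => ((z ^ k : Circle) : ℂ) :=
        continuous_subtype_val.comp (continuous_zpow k)
      have := (hcont.tendsto 1).comp (tendsto_comap (f := fun j : ℕ => c ^ j))
      simp only [one_zpow, Circle.coe_one] at this
      refine this.congr fun j => ?_
      simp only [Function.comp_apply]
      rw [← zpow_natCast, ← zpow_mul, ← zpow_natCast, ← zpow_mul, mul_comm]
    simpa using h1.smul_const (((u ^ k : unitary B) : B) * circleCalculusHom v g)

/-- Faithfulness of the expectation. By almost periodicity and minimality, among any `N`
consecutive conjugates of `a` at least one is `ε`-close to `a`, so averaging gives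
`a ≤ N E(a) + ε`. -/
theorem eq_zero_of_hasExpectation_zero [PartialOrder B] [StarOrderedRing B] {u v : unitary B}
    {c : Circle} (hc : DenseRange fun n : ℕ => c ^ n)
    (h : (v : B) * u = (c : ℂ) • ((u : B) * v)) {a : B} (ha : a ∈ rotationSpan u v)
    (ha0 : 0 ≤ a) (hE : HasExpectation v a 0) : a = 0 := by
  rcases subsingleton_or_nontrivial B with hB | hB
  · exact Subsingleton.elim _ _
  rw [← norm_eq_zero]
  refine le_antisymm (le_of_forall_pos_le_add fun ε hε => ?_) (norm_nonneg a)
  let α : ℕ → B → B := fun j => Unitary.conjStarAlgAut ℂ B (v ^ j)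
  have hα0 : ∀ j b, 0 ≤ b → 0 ≤ α j b := fun j b hb => star_right_conjugate_nonneg hb _
  obtain ⟨U, hU, hUα⟩ := mem_comap.1 (Metric.tendsto_nhds.1 (tendsto_conj_pow h ha) (ε / 2)
    (half_pos hε))
  obtain ⟨N, hN⟩ := exists_forall_exists_lt_pow_mul_mem hc hU
  -- Of the `N` positive terms on the right, one is close to `a`; the others are dropped.
  have hle : ∀ j, a ≤ ∑ i ∈ Finset.range N, α i (α j a) + algebraMap ℝ B (ε / 2) := by
    intro j
    obtain ⟨i, hi, hij⟩ := hN (c ^ j)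
    have hdist : ‖α (i + j) a - a‖ < ε / 2 := by
      have : i + j ∈ (fun j : ℕ => c ^ j) ⁻¹' U := by simpa [pow_add] using hij
      have hlt := hUα this
      rwa [Set.mem_ofPred_eq, dist_eq_norm] at hlt
    have hadd : α (i + j) a = α i (α j a) := by
      simp only [α, pow_add, map_mul]; rfl
    have hsa : IsSelfAdjoint (α (i + j) a - a) :=
      (IsSelfAdjoint.of_nonneg (hα0 _ _ ha0)).sub (.of_nonneg ha0)
    have h1 : a ≤ α (i + j) a + algebraMap ℝ B (ε / 2) := by
      have h2 := hsa.neg_algebraMap_norm_le_self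
      have h3 : algebraMap ℝ B ‖α (i + j) a - a‖ ≤ algebraMap ℝ B (ε / 2) :=
        algebraMap_le_algebraMap.2 hdist.le
      have h4 := neg_le_iff_add_nonneg.1 ((neg_le_neg h3).trans h2)
      rw [← sub_nonneg]
      convert h4 using 1
      abel
    refine h1.trans (add_le_add_left ?_ _)
    rw [hadd]
    exact Finset.single_le_sum (f := fun i => α i (α j a))
      (fun i _ => hα0 _ _ (hα0 _ _ ha0)) (Finset.mem_range.2 hi)
  have hE0 : Tendsto (fun n => (N : ℝ) * ‖conjAverage v n a‖) atTop (𝓝 0) := by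
    have : Tendsto (fun n => conjAverage v n a) atTop (𝓝 0) := by
      simpa [HasExpectation] using hE
    simpa using this.norm.const_mul (N : ℝ)
  obtain ⟨n, hnε, hn⟩ := ((hE0.eventually (gt_mem_nhds (half_pos hε))).and
    (eventually_gt_atTop 0)).exists
  have hn' : (0 : ℝ) < n := by exact_mod_cast hn
  have hsum : (n : ℂ) • a ≤ (n : ℂ) • (∑ i ∈ Finset.range N, α i (conjAverage v n a) +
      algebraMap ℝ B (ε / 2)) := by
    have h1 := Finset.sum_le_sum fun j (_ : j ∈ Finset.range n) => hle j
    rw [Finset.sum_const, Finset.card_range, Finset.sum_add_distrib, Finset.sum_const,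
      Finset.card_range, Finset.sum_comm] at h1
    convert h1 using 1
    · rw [Nat.cast_smul_eq_nsmul]
    · rw [smul_add, Nat.cast_smul_eq_nsmul ℂ n (algebraMap ℝ B _), Finset.smul_sum]
      congr 1
      refine Finset.sum_congr rfl fun i _ => ?_
      have hnC : (n : ℂ) ≠ 0 := by exact_mod_cast hn.ne'
      simp only [α, conjAverage_apply]
      rw [map_smul, smul_smul, mul_inv_cancel₀ hnC, one_smul, map_sum]
  have hnorm := CStarAlgebra.norm_le_norm_of_nonneg_of_le
    (by rw [Nat.cast_smul_eq_nsmul]; exact nsmul_nonneg ha0 n) hsum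
  rw [norm_smul, norm_smul, Complex.norm_natCast] at hnorm
  have h5 := le_of_mul_le_mul_left hnorm hn'
  refine h5.trans ((norm_add_le _ _).trans ?_)
  have h6 : ‖∑ i ∈ Finset.range N, α i (conjAverage v n a)‖ ≤ N * ‖conjAverage v n a‖ := by
    refine (norm_sum_le _ _).trans ?_
    simp only [α, norm_conjStarAlgAut, Finset.sum_const, Finset.card_range, nsmul_eq_mul, le_refl]
  have h7 : ‖algebraMap ℝ B (ε / 2)‖ = ε / 2 := by
    rw [norm_algebraMap', Real.norm_of_nonneg (half_pos hε).le]
  linarith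

end Expectation

/-! ### Simplicity -/

section Simplicity

variable {B : Type*} [CStarAlgebra B]

/-- The squared modulus `z ↦ |f z| ^ 2` as a complex valued function. -/
noncomputable def normSqFun (f : C(Circle, ℂ)) : C(Circle, ℂ) := star f * f

theorem normSqFun_apply (f : C(Circle, ℂ)) (z : Circle) :
    normSqFun f z = ((‖f z‖ ^ 2 : ℝ) : ℂ) := by
  rw [Complex.ofReal_pow, ← Complex.conj_mul']
  rfl

theorem normSqFun_ne_zero {f : C(Circle, ℂ)} {z : Circle} : normSqFun f z ≠ 0 ↔ f z ≠ 0 := by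
  simp [normSqFun_apply]

theorem not_isCirclePeriodic_normSqFun {f : C(Circle, ℂ)}
    (hf : ¬ IsCirclePeriodic fun z => ‖f z‖) : ¬ IsCirclePeriodic (normSqFun f) := by
  rintro ⟨w, hw, h⟩
  refine hf ⟨w, hw, fun z => ?_⟩
  have := h z
  rw [normSqFun_apply, normSqFun_apply, Complex.ofReal_inj] at this
  exact (sq_eq_sq₀ (norm_nonneg _) (norm_nonneg _)).1 this

theorem not_isCirclePeriodic_circleTranslate {g : C(Circle, ℂ)} (hg : ¬ IsCirclePeriodic g)
    (d : Circle) : ¬ IsCirclePeriodic (circleTranslate d g) := by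
  rintro ⟨w, hw, h⟩
  refine hg ⟨w, hw, fun z => ?_⟩
  have := h (d⁻¹ * z)
  rwa [circleTranslate_apply, circleTranslate_apply, mul_inv_cancel_left, mul_left_comm,
    mul_inv_cancel_left] at this

theorem star_generator_mul_circleCalculusHom_mul {u v : unitary B} {c : Circle}
    (h : (v : B) * u = (c : ℂ) • ((u : B) * v)) (f g : C(Circle, ℂ)) :
    star ((u : B) * circleCalculusHom v f) * circleCalculusHom v g *
      ((u : B) * circleCalculusHom v f) =
      circleCalculusHom v (normSqFun f * circleTranslate c g) := by
  have : normSqFun f * circleTranslate c g = star f * circleTranslate c g * f := by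
    rw [normSqFun]; ring
  rw [this, map_mul, map_mul, map_star, ← star_mul_circleCalculusHom_mul h, star_mul]
  simp only [mul_assoc]

theorem generator_mul_circleCalculusHom_mul_star {u v : unitary B} {c : Circle}
    (h : (v : B) * u = (c : ℂ) • ((u : B) * v)) (f g : C(Circle, ℂ)) :
    ((u : B) * circleCalculusHom v f) * circleCalculusHom v g *
      star ((u : B) * circleCalculusHom v f) =
      circleCalculusHom v (circleTranslate c⁻¹ (normSqFun f) * circleTranslate c⁻¹ g) := by
  have : normSqFun f * g = f * g * star f := by
    rw [normSqFun]; ring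
  rw [← map_mul, this, ← star_mul_circleCalculusHom_mul (rotation_star h), star_mul, map_mul,
    map_mul, map_star]
  simp only [mul_assoc, Unitary.coe_star, star_star]

/-- If no two zeros of `f` lie on the same orbit, then every point has a forward orbit or a strictly
backward orbit that avoids the zeros of `f`. -/
theorem forall_ne_zero_or_forall_ne_zero {c : Circle} {f : C(Circle, ℂ)}
    (hY : ∀ n : ℤ, n ≠ 0 → ∀ z, f z = 0 → f (c ^ n * z) ≠ 0) (z : Circle) :
    (∀ n : ℕ, normSqFun f (c ^ n * z) ≠ 0) ∨
      ∀ n : ℕ, circleTranslate c⁻¹ (normSqFun f) (c⁻¹ ^ n * z) ≠ 0 := by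
  simp only [circleTranslate_apply, normSqFun_ne_zero]
  by_contra! hcon
  obtain ⟨⟨n, hn⟩, k, hk⟩ := hcon
  refine hY (-(n + k + 1 : ℤ)) (by omega) _ hn ?_
  rw [← hk]
  congr 1
  rw [← mul_assoc, ← mul_assoc, ← zpow_natCast c n, ← zpow_add, inv_pow, ← zpow_natCast c k,
    ← zpow_neg_one, ← zpow_neg, ← zpow_add]
  congr 2
  ring

theorem generator_mem_cstarGenerated (u v : unitary B) (f : C(Circle, ℂ)) :
    (u : B) * circleCalculusHom v f ∈ cstarGenerated u v f :=
  StarAlgebra.elemental.self_mem ℂ _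

/-- If `|f|` is not periodic and no two zeros of `f` lie on the same orbit, then the algebra
generated by `u f(v)` contains all `g(v)`: the functions `g` with `g(v)` in the algebra form a closed
star algebra that is stable under both weighted translations, hence separates points. -/
theorem circleCalculusHom_mem_cstarGenerated {u v : unitary B} {c : Circle}
    (hc : DenseRange fun n : ℕ => c ^ n) (h : (v : B) * u = (c : ℂ) • ((u : B) * v))
    {f : C(Circle, ℂ)} (hf : ¬ IsCirclePeriodic fun z => ‖f z‖)
    (hY : ∀ n : ℤ, n ≠ 0 → ∀ z, f z = 0 → f (c ^ n * z) ≠ 0) (g : C(Circle, ℂ)) :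
    circleCalculusHom v g ∈ cstarGenerated u v f := by
  let D : StarSubalgebra ℂ C(Circle, ℂ) :=
    (cstarGenerated u v f).comap (circleCalculusHom v)
  have hX := generator_mem_cstarGenerated u v f
  have hfwd : ∀ g ∈ D, normSqFun f * circleTranslate c g ∈ D := by
    intro g hg
    have hg : circleCalculusHom v g ∈ cstarGenerated u v f := hg
    change circleCalculusHom v _ ∈ cstarGenerated u v f
    rw [← star_generator_mul_circleCalculusHom_mul h]
    exact mul_mem (mul_mem (star_mem hX) hg) hX
  have hbwd : ∀ g ∈ D, circleTranslate c⁻¹ (normSqFun f) * circleTranslate c⁻¹ g ∈ D := by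
    intro g hg
    have hg : circleCalculusHom v g ∈ cstarGenerated u v f := hg
    change circleCalculusHom v _ ∈ cstarGenerated u v f
    rw [← generator_mul_circleCalculusHom_mul_star h]
    exact mul_mem (mul_mem hX hg) (star_mem hX)
  have hm := not_isCirclePeriodic_normSqFun hf
  have htop : D = ⊤ := by
    refine starSubalgebra_eq_top_of_separates D ?_ fun z w hzw => ?_
    · exact (StarAlgebra.elemental.isClosed ℂ _).preimage (continuous_circleCalculusHom v)
    · rcases forall_ne_zero_or_forall_ne_zero hY z with hz | hz
      · exact eq_of_forall_weightedTranslation_eq hc hm (D := D) (one_mem D) hfwd hz hzw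
      · exact eq_of_forall_weightedTranslation_eq (denseRange_inv_pow hc)
          (not_isCirclePeriodic_circleTranslate hm c⁻¹) (D := D) (one_mem D) hbwd hz hzw
  have : g ∈ D := htop ▸ StarSubalgebra.mem_top
  exact this

/-- Under the hypotheses of `circleCalculusHom_mem_cstarGenerated`, the generated algebra is simple.
The expectation of a nonzero positive element of an ideal is a nonzero `h(v)` in the closure of the
ideal. The functions `g` with `g(v)` in this closure form an ideal of `C(S¹)` stable under both
weighted translations, hence without common zeros, and so the given ideal contains a unit. -/
theorem isSimpleRing_cstarGenerated [Nontrivial B] {u v : unitary B} {c : Circle}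
    (hc : DenseRange fun n : ℕ => c ^ n) (h : (v : B) * u = (c : ℂ) • ((u : B) * v))
    {f : C(Circle, ℂ)} (hf : ¬ IsCirclePeriodic fun z => ‖f z‖)
    (hY : ∀ n : ℤ, n ≠ 0 → ∀ z, f z = 0 → f (c ^ n * z) ≠ 0) :
    IsSimpleRing (cstarGenerated u v f) := by
  have hmem := circleCalculusHom_mem_cstarGenerated hc h hf hY
  have : CompleteSpace (cstarGenerated u v f) :=
    (StarAlgebra.elemental.isClosed ℂ _).completeSpace_coe
  refine IsSimpleRing.of_eq_bot_or_eq_top fun J => or_iff_not_imp_left.2 fun hJ => ?_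
  obtain ⟨x, hxJ, hx0⟩ : ∃ x ∈ J, x ≠ 0 := by
    by_contra! hcon
    exact hJ (eq_bot_iff.2 fun x hx => by simpa using hcon x hx)
  let S : C(Circle, ℂ) →⋆ₐ[ℂ] cstarGenerated u v f := (circleCalculusHom v).codRestrict _ hmem
  let K : Ideal (cstarGenerated u v f) := (TwoSidedIdeal.asIdeal J).closure
  let I : Ideal C(Circle, ℂ) := K.comap S
  have hconj : ∀ (a b : cstarGenerated u v f) {y}, y ∈ K → a * y * b ∈ K := by
    intro a b y hy
    refine map_mem_closure (f := fun y => a * y * b) (by fun_prop) hy fun y hy => ?_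
    exact J.mul_mem_right _ _ (J.mul_mem_left _ _ hy)
  let X : cstarGenerated u v f := ⟨_, generator_mem_cstarGenerated u v f⟩
  have hfwd : ∀ g ∈ I, normSqFun f * circleTranslate c g ∈ I := by
    intro g hg
    have h1 := hconj (star X) X (show S g ∈ K from hg)
    have h2 : star X * S g * X = S (normSqFun f * circleTranslate c g) :=
      Subtype.ext (star_generator_mul_circleCalculusHom_mul h f g)
    exact (h2 ▸ h1 :)
  have hbwd : ∀ g ∈ I, circleTranslate c⁻¹ (normSqFun f) * circleTranslate c⁻¹ g ∈ I := by
    intro g hg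
    have h1 := hconj X (star X) (show S g ∈ K from hg)
    have h2 : X * S g * star X =
        S (circleTranslate c⁻¹ (normSqFun f) * circleTranslate c⁻¹ g) :=
      Subtype.ext (generator_mul_circleCalculusHom_mul_star h f g)
    exact (h2 ▸ h1 :)
  -- The expectation of `x* x` is the limit of averages taken inside `J`, because `v` belongs to the
  -- algebra, and it is nonzero by faithfulness.
  obtain ⟨g, hgI, hg0⟩ : ∃ g ∈ I, g ≠ 0 := by
    let := CStarAlgebra.spectralOrder B
    have := CStarAlgebra.spectralOrderedRing B
    have hW : star (x : B) * x ∈ rotationSpan u v :=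
      cstarGenerated_le_rotationSpan h (mul_mem (star_mem x.2) x.2)
    obtain ⟨g, hg⟩ := exists_hasExpectation hc h hW
    refine ⟨g, ?_, ?_⟩
    · have hVmem : ∀ j : ℕ, ((v ^ j : unitary B) : B) ∈ cstarGenerated u v f := by
        intro j
        simpa using pow_mem (hmem circleCoord) j
      let V : ℕ → cstarGenerated u v f := fun j => ⟨_, hVmem j⟩
      let y : ℕ → cstarGenerated u v f := fun n =>
        (n : ℂ)⁻¹ • ∑ j ∈ Finset.range n, V j * (star x * x) * star (V j)
      have hyJ : ∀ n, y n ∈ (TwoSidedIdeal.asIdeal J : Set (cstarGenerated u v f)) := by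
        intro n
        refine Submodule.smul_of_tower_mem (TwoSidedIdeal.asIdeal J) _ (sum_mem fun j _ => ?_)
        exact J.mul_mem_right _ _ (J.mul_mem_left _ _ (J.mul_mem_left _ _ hxJ))
      have hyS : Tendsto y atTop (𝓝 (S g)) := by
        rw [tendsto_subtype_rng]
        refine Tendsto.congr (fun n => ?_) hg
        simp [y, V, conjAverage_apply, -map_pow]
      exact mem_closure_of_tendsto hyS (Eventually.of_forall hyJ)
    · rintro rfl
      have h0 := eq_zero_of_hasExpectation_zero hc h hW (star_mul_self_nonneg _) hg
      exact hx0 (Subtype.ext (CStarRing.star_mul_self_eq_zero_iff _ |>.1 h0))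
  have hI : I = ⊤ := by
    refine ideal_eq_top_of_forall_exists_ne_zero I fun z => ?_
    by_contra! hz
    rcases forall_ne_zero_or_forall_ne_zero hY z with hz' | hz'
    · exact hg0 (eq_zero_of_weightedTranslation_mem hc (I := I) hfwd hz' hz g hgI)
    · exact hg0 (eq_zero_of_weightedTranslation_mem (denseRange_inv_pow hc) (I := I) hbwd hz' hz g
        hgI)
  have h1 : (1 : cstarGenerated u v f) ∈ K := by
    have : (1 : C(Circle, ℂ)) ∈ I := hI ▸ Submodule.mem_top
    simpa using! (show S 1 ∈ K from this)
  -- The closure of a proper ideal is proper, since the units form an open set.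
  have hK : TwoSidedIdeal.asIdeal J = ⊤ := by
    by_contra hne
    exact Ideal.closure_ne_top _ hne ((Ideal.eq_top_iff_one _).2 h1)
  have h2 : (1 : cstarGenerated u v f) ∈ TwoSidedIdeal.asIdeal J := hK ▸ Submodule.mem_top
  exact (TwoSidedIdeal.one_mem_iff J).1 h2

end Simplicity

/-! ### Finite-dimensional representations on orbit segments -/

section FiniteDimensionalRepresentation

variable {B : Type*} [CStarAlgebra B]

/-- Evaluation of the expectation at a point of the circle, extended to a continuous functional on
the whole algebra by the Hahn-Banach theorem. -/
theorem exists_functional_hasExpectation {v : unitary B}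
    (hv : Function.Injective (circleCalculusHom v)) (ζ : Circle) :
    ∃ ε : B →L[ℂ] ℂ, ∀ b g, HasExpectation v b g → ε b = g ζ := by
  have huniq : ∀ {b g g'}, HasExpectation v b g → HasExpectation v b g' → g = g' :=
    fun h h' => hv (tendsto_nhds_unique h h')
  let N : Submodule ℂ B :=
    { carrier := {b | ∃ g, HasExpectation v b g}
      zero_mem' := ⟨0, by simp [HasExpectation]⟩
      add_mem' := fun ⟨g, hg⟩ ⟨g', hg'⟩ => ⟨g + g', hg.add hg'⟩
      smul_mem' := fun z _ ⟨g, hg⟩ => ⟨z • g, hg.smul z⟩ }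
  choose E hE using fun b : N => b.2
  let L : N →ₗ[ℂ] ℂ :=
    { toFun := fun b => E b ζ
      map_add' := fun a b => by
        rw [huniq (hE (a + b)) ((hE a).add (hE b))]; rfl
      map_smul' := fun z a => by
        rw [huniq (hE (z • a)) ((hE a).smul z)]; rfl }
  have hL : ∀ b : N, ‖L b‖ ≤ 1 * ‖b‖ := fun b => by
    rw [one_mul]
    refine ((E b).norm_coe_le_norm ζ).trans ?_
    rw [← NonUnitalStarAlgHom.norm_map (circleCalculusHom v) hv]
    exact (hE b).norm_le
  obtain ⟨ε, hε, -⟩ := exists_extension_norm_eq N (L.mkContinuous 1 hL)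
  refine ⟨ε, fun b g hg => ?_⟩
  rw [hε ⟨b, g, hg⟩]
  change E ⟨b, g, hg⟩ ζ = g ζ
  rw [huniq (hE ⟨b, g, hg⟩) hg]

/-- The coefficient `b ↦ ε (u ^ (-i) b)`. If `ε` is the evaluation of the expectation at `ζ`, these
are the coordinates along the orbit of `ζ` of the vector of `ℓ²(ℤ)` that `b` gives when applied to
the base point. -/
noncomputable def orbitCoeff (u : unitary B) (ε : B →L[ℂ] ℂ) (i : ℤ) : B →L[ℂ] ℂ :=
  ε.comp (ContinuousLinearMap.mul ℂ B ((u ^ (-i) : unitary B) : B))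

theorem orbitCoeff_apply (u : unitary B) (ε : B →L[ℂ] ℂ) (i : ℤ) (b : B) :
    orbitCoeff u ε i b = ε (((u ^ (-i) : unitary B) : B) * b) := rfl

theorem orbitCoeff_unitary_mul (u : unitary B) (ε : B →L[ℂ] ℂ) (i : ℤ) (b : B) :
    orbitCoeff u ε i ((u : B) * b) = orbitCoeff u ε (i - 1) b := by
  rw [orbitCoeff_apply, orbitCoeff_apply, ← mul_assoc, ← Submonoid.coe_mul, ← zpow_add_one]
  congr 5
  ring

theorem orbitCoeff_star_mul (u : unitary B) (ε : B →L[ℂ] ℂ) (i : ℤ) (b : B) :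
    orbitCoeff u ε i (star (u : B) * b) = orbitCoeff u ε (i + 1) b := by
  rw [← Unitary.coe_star, Unitary.star_eq_inv, orbitCoeff_apply, orbitCoeff_apply, ← mul_assoc,
    ← Submonoid.coe_mul, ← zpow_sub_one]
  congr 5
  ring

theorem orbitCoeff_zpow {u v : unitary B} {c : Circle} (hc : DenseRange fun n : ℕ => c ^ n)
    (h : (v : B) * u = (c : ℂ) • ((u : B) * v)) {ζ : Circle} {ε : B →L[ℂ] ℂ}
    (hε : ∀ b g, HasExpectation v b g → ε b = g ζ) (i k : ℤ) :
    orbitCoeff u ε i (u ^ k : unitary B) = if i = k then 1 else 0 := by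
  have := hasExpectation_monomial hc h (-i + k) 1
  rw [map_one, mul_one] at this
  rw [orbitCoeff_apply, ← Submonoid.coe_mul, ← zpow_add, hε _ _ this]
  split_ifs with h1 h2 h2
  · rfl
  · omega
  · omega
  · rfl

/-- A functional proportional to a coefficient of the block `0, …, n - 1` is determined by its values
at the powers of `u` with exponent in this block. -/
theorem eq_sum_orbitCoeff {u v : unitary B} {c : Circle} (hc : DenseRange fun n : ℕ => c ^ n)
    (h : (v : B) * u = (c : ℂ) • ((u : B) * v)) {ζ : Circle} {ε : B →L[ℂ] ℂ}
    (hε : ∀ b g, HasExpectation v b g → ε b = g ζ) {n : ℕ} {q : B → ℂ} {z : ℂ} {m : ℤ}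
    (hq : ∀ b ∈ rotationSpan u v, q b = z * orbitCoeff u ε m b)
    (hm : z = 0 ∨ ∃ k : Fin n, m = (k : ℤ)) {b : B} (hb : b ∈ rotationSpan u v) :
    q b = ∑ k : Fin n, q (u ^ (k : ℤ) : unitary B) * orbitCoeff u ε k b := by
  have hu : ∀ k : ℤ, ((u ^ k : unitary B) : B) ∈ rotationSpan u v := fun k => by
    simpa using zpow_mul_mem_rotationSpan u v k 1
  simp only [hq b hb, hq _ (hu _), orbitCoeff_zpow hc h hε]
  rcases hm with rfl | ⟨k, rfl⟩
  · simp
  · simp [Fin.val_inj]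

section

variable [Nontrivial B] {u v : unitary B} {c : Circle}
  (hc : DenseRange fun n : ℕ => c ^ n) (h : (v : B) * u = (c : ℂ) • ((u : B) * v))
  {ζ : Circle} {ε : B →L[ℂ] ℂ} (hε : ∀ b g, HasExpectation v b g → ε b = g ζ)
include hc h hε

theorem orbitCoeff_circleCalculusHom_mul (i : ℤ) (g : C(Circle, ℂ)) {b : B}
    (hb : b ∈ rotationSpan u v) :
    orbitCoeff u ε i (circleCalculusHom v g * b) = g (c ^ i * ζ) * orbitCoeff u ε i b := by
  obtain ⟨k, hk⟩ := exists_hasExpectation hc h (unitary_zpow_mul_mem_rotationSpan (-i) hb)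
  have hcov := circleCalculusHom_mul_unitary (rotation_zpow h (-i))
    (circleTranslate (c ^ i) g)
  rw [circleTranslate_circleTranslate, ← zpow_add, add_neg_cancel, zpow_zero,
    circleTranslate_one] at hcov
  rw [orbitCoeff_apply, orbitCoeff_apply, ← mul_assoc, ← hcov, mul_assoc, hε _ _ hk,
    hε _ _ (hk.circleCalculusHom_mul _)]
  rfl

variable {f : C(Circle, ℂ)}

theorem orbitCoeff_generator_mul (i : ℤ) {b : B} (hb : b ∈ rotationSpan u v) :
    orbitCoeff u ε i ((u : B) * circleCalculusHom v f * b) =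
      f (c ^ (i - 1) * ζ) * orbitCoeff u ε (i - 1) b := by
  rw [mul_assoc, orbitCoeff_unitary_mul, orbitCoeff_circleCalculusHom_mul hc h hε _ _ hb]

theorem orbitCoeff_star_generator_mul (i : ℤ) {b : B} (hb : b ∈ rotationSpan u v) :
    orbitCoeff u ε i (star ((u : B) * circleCalculusHom v f) * b) =
      star (f (c ^ i * ζ)) * orbitCoeff u ε (i + 1) b := by
  have hb' : star (u : B) * b ∈ rotationSpan u v := by
    have := unitary_zpow_mul_mem_rotationSpan (-1) hb
    rwa [zpow_neg_one, ← Unitary.star_eq_inv, Unitary.coe_star] at this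
  rw [star_mul, mul_assoc, ← map_star, orbitCoeff_circleCalculusHom_mul hc h hε _ _ hb',
    orbitCoeff_star_mul]
  rfl

/-- If `f` vanishes just before and at the end of the orbit segment `ζ, …, c ^ (n - 1) ζ`, then the
span of this segment reduces the generated algebra, which therefore acts on it by matrices. -/
theorem orbitCoeff_mul {n : ℕ} (h0 : f (c ^ (-1 : ℤ) * ζ) = 0)
    (hn : f (c ^ (n - 1 : ℤ) * ζ) = 0) {a : B} (ha : a ∈ cstarGenerated u v f) :
    ∀ (i : Fin n) {b : B}, b ∈ rotationSpan u v → orbitCoeff u ε i (a * b) =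
      ∑ k : Fin n, orbitCoeff u ε i (a * (u ^ (k : ℤ) : unitary B)) * orbitCoeff u ε k b := by
  have hu : ∀ k : ℤ, ((u ^ k : unitary B) : B) ∈ rotationSpan u v := fun k => by
    simpa using zpow_mul_mem_rotationSpan u v k 1
  induction ha using StarAlgebra.elemental.induction_on with
  | self =>
    intro i b hb
    refine eq_sum_orbitCoeff hc h hε (q := fun b => orbitCoeff u ε i (_ * b))
      (fun b hb => orbitCoeff_generator_mul hc h hε i hb) ?_ hb
    -- `u f(v)` lowers the index; at the first index its weight is `f (c⁻¹ ζ) = 0`.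
    rcases Nat.eq_zero_or_pos i with hi | hi
    · left
      simpa [hi] using h0
    · right
      exact ⟨⟨i - 1, by omega⟩, by simp; omega⟩
  | star_self =>
    intro i b hb
    refine eq_sum_orbitCoeff hc h hε (q := fun b => orbitCoeff u ε i (_ * b))
      (fun b hb => orbitCoeff_star_generator_mul hc h hε i hb) ?_ hb
    -- The adjoint raises the index; at the last index its weight is `f (c ^ (n - 1) ζ) = 0`.
    by_cases hi : (i : ℕ) + 1 < n
    · right
      exact ⟨⟨i + 1, hi⟩, by simp⟩
    · left
      have : (i : ℤ) = n - 1 := by omega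
      rw [this, hn, star_zero]
  | algebraMap r =>
    intro i b hb
    refine eq_sum_orbitCoeff hc h hε (q := fun b => orbitCoeff u ε i (_ * b)) (z := r) (m := i)
      (fun b hb => ?_) (.inr ⟨i, rfl⟩) hb
    rw [← Algebra.smul_def, map_smul, smul_eq_mul]
  | add x _ y _ hx hy =>
    intro i b hb
    simp only [add_mul, map_add, hx i hb, hy i hb, Finset.sum_add_distrib]
  | mul x hx' y hy' hx hy =>
    intro i b hb
    simp only [mul_assoc]
    rw [hx i (mul_mem_rotationSpan h hy' hb)]
    simp only [hy _ hb, hx i (mul_mem_rotationSpan h hy' (hu _)), Finset.mul_sum, Finset.sum_mul]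
    rw [Finset.sum_comm]
    simp only [mul_assoc]
  | closure s _ hs x hx =>
    intro i b hb
    exact closure_minimal (t := {a | orbitCoeff u ε i (a * b) =
      ∑ k : Fin n, orbitCoeff u ε i (a * (u ^ (k : ℤ) : unitary B)) * orbitCoeff u ε k b})
      (fun y hy => hs y hy i hb) (isClosed_eq (by fun_prop) (by fun_prop)) hx

/-- The representation of the generated algebra on an orbit segment bounded by zeros of `f`. -/
theorem exists_algHom_matrix {n : ℕ} (h0 : f (c ^ (-1 : ℤ) * ζ) = 0)
    (hn : f (c ^ (n - 1 : ℤ) * ζ) = 0) :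
    Nonempty (cstarGenerated u v f →ₐ[ℂ] Matrix (Fin n) (Fin n) ℂ) := by
  let L : cstarGenerated u v f →ₗ[ℂ] Matrix (Fin n) (Fin n) ℂ :=
    { toFun := fun a => .of fun i j => orbitCoeff u ε i (a * (u ^ (j : ℤ) : unitary B))
      map_add' := fun a b => by ext; simp [add_mul]
      map_smul' := fun z a => by ext; simp }
  refine ⟨AlgHom.ofLinearMap L ?_ fun a b => ?_⟩
  · ext i j
    change orbitCoeff u ε i (1 * (u ^ (j : ℤ) : unitary B)) = _
    rw [one_mul, orbitCoeff_zpow hc h hε, Matrix.one_apply]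
    simp [Fin.val_inj]
  · ext i j
    change orbitCoeff u ε i ((a * b : B) * (u ^ (j : ℤ) : unitary B)) = _
    have hu : ((u ^ (j : ℤ) : unitary B) : B) ∈ rotationSpan u v := by
      simpa using zpow_mul_mem_rotationSpan u v j 1
    rw [mul_assoc, orbitCoeff_mul hc h hε h0 hn a.2 i (mul_mem_rotationSpan h b.2 hu)]
    rfl

end

/-- An algebraic function takes finitely many values, hence only one on the connected circle. -/
theorem eq_of_isIntegral_circle {g : C(Circle, ℂ)} (hg : IsIntegral ℂ g) (z w : Circle) :
    g z = g w := by
  obtain ⟨p, hp, hpg⟩ := hg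
  have hroot : ∀ x, g x ∈ (p.rootSet ℂ) := by
    intro x
    refine Polynomial.mem_rootSet.2 ⟨hp.ne_zero, ?_⟩
    have h1 : ContinuousMap.evalAlgHom ℂ ℂ x (Polynomial.aeval g p) = 0 := by
      rw [Polynomial.aeval_def, hpg, map_zero]
    rwa [← Polynomial.aeval_algHom_apply] at h1
  by_contra hne
  exact (isPreconnected_range g.continuous).infinite_of_nontrivial ⟨_, ⟨z, rfl⟩, _, ⟨w, rfl⟩, hne⟩
    ((p.rootSet_finite ℂ).subset (Set.range_subset_iff.2 hroot))

/-- If the generated algebra is simple and `|f|` is not periodic, then no two zeros of `f` lie on the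
same orbit: otherwise the representation on the orbit segment between them is faithful, so
`|f| ^ 2` is algebraic over `ℂ`, hence constant. -/
theorem ne_zero_of_isSimpleRing [Nontrivial B] {u v : unitary B} {c : Circle}
    (hc : DenseRange fun n : ℕ => c ^ n) (h : (v : B) * u = (c : ℂ) • ((u : B) * v))
    {f : C(Circle, ℂ)} (hf : ¬ IsCirclePeriodic fun z => ‖f z‖)
    (hA : IsSimpleRing (cstarGenerated u v f)) {n : ℕ} (hn : 0 < n) {z : Circle} (hz : f z = 0) :
    f (c ^ n * z) ≠ 0 := by
  intro hnz
  have hv := circleCalculusHom_injective hc h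
  -- The segment starts at `c z`, just after the zero `z`, and ends at the zero `c ^ n z`.
  obtain ⟨ε, hε⟩ := exists_functional_hasExpectation hv (c * z)
  obtain ⟨π⟩ := exists_algHom_matrix (f := f) (n := n) hc h hε (by simpa using hz) (by
    rw [← mul_assoc, ← zpow_add_one, sub_add_cancel, zpow_natCast, hnz])
  have : Nonempty (Fin n) := ⟨⟨0, hn⟩⟩
  have hπ : Function.Injective π := RingHom.injective π.toRingHom
  let X : cstarGenerated u v f := ⟨_, generator_mem_cstarGenerated u v f⟩
  have hX : IsIntegral ℂ (star X * X) :=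
    (isIntegral_algHom_iff π hπ).1 (Algebra.IsIntegral.isIntegral _)
  have hX' : IsIntegral ℂ (circleCalculusHom v (normSqFun f)) := by
    have h1 := star_generator_mul_circleCalculusHom_mul h f 1
    rw [map_one, mul_one, map_one, mul_one] at h1
    rw [← h1]
    exact hX.map (cstarGenerated u v f).subtype
  have hint : IsIntegral ℂ (normSqFun f) :=
    (isIntegral_algHom_iff (circleCalculusHom v).toAlgHom hv).1 hX'
  exact not_isCirclePeriodic_normSqFun hf ⟨c,
    by simpa using zpow_ne_one_of_denseRange_pow hc one_ne_zero,
    fun z => eq_of_isIntegral_circle hint _ _⟩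

end FiniteDimensionalRepresentation

/-! ### The equivalence -/

theorem circleRotation_zpow_apply (θ : ℝ) (n : ℤ) (z : Circle) :
    (circleRotation θ ^ n) z = Circle.exp (2 * Real.pi * θ) ^ n * z := by
  have : circleRotation θ ^ n = Equiv.mulLeft (Circle.exp (2 * Real.pi * θ) ^ n) :=
    (map_zpow (MulAction.toPermHom Circle Circle) _ n).symm
  rw [this]
  rfl

theorem mainTheorem8 {B : Type*} [CStarAlgebra B] [Nontrivial B]
    (θ : ℝ) (hθ : Irrational θ) (u v : unitary B)
    (huv : (v : B) * (u : B) = Complex.exp (2 * Real.pi * Complex.I * θ) • ((u : B) * (v : B)))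
    (f : C(Circle, ℂ)) (hf : ¬ IsCirclePeriodic (fun z => ‖f z‖)) :
    List.TFAE [
      IsSimpleRing (cstarGenerated u v f),
      ∀ n : ℤ, n ≠ 0 → ((circleRotation θ ^ n) '' zeroSet f) ∩ zeroSet f = ∅,
      ∀ ξ : Circle, (rotationOrbit θ ξ ∩ zeroSet f).Subsingleton,
      (⋃ n : ℕ, (circleRotation θ ^ (n : ℤ)) '' zeroSet f) ∩
        (⋃ k : ℕ, ⋃ _ : 1 ≤ k, (circleRotation θ ^ (-(k : ℤ))) '' zeroSet f) = ∅] := by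
  have hc := denseRange_circleExp_pow hθ
  have h : (v : B) * u = ((Circle.exp (2 * Real.pi * θ) : Circle) : ℂ) • ((u : B) * v) := by
    rw [huv, Circle.coe_exp]
    congr 2
    push_cast
    ring
  -- It is enough to exclude pairs of zeros with a positive time difference.
  have hpos : (∀ n : ℕ, 0 < n → ∀ z, f z = 0 →
      f (Circle.exp (2 * Real.pi * θ) ^ n * z) ≠ 0) →
      ∀ n : ℤ, n ≠ 0 → ∀ z, f z = 0 → f (Circle.exp (2 * Real.pi * θ) ^ n * z) ≠ 0 := by
    intro H n hn z hz hnz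
    rcases lt_or_gt_of_ne hn with hn | hn
    · refine H n.natAbs (by omega) _ hnz ?_
      rw [← zpow_natCast, ← mul_assoc, ← zpow_add, show (n.natAbs : ℤ) + n = 0 by omega, zpow_zero,
        one_mul, hz]
    · refine H n.natAbs (by omega) z hz ?_
      rw [← zpow_natCast, show (n.natAbs : ℤ) = n by omega, hnz]
  set c := Circle.exp (2 * Real.pi * θ) with hcdef
  have hrot : ∀ (n : ℤ) z, (circleRotation θ ^ n) z = c ^ n * z := circleRotation_zpow_apply θ
  tfae_have 1 → 2 := by
    intro hA n hn
    refine Set.eq_empty_iff_forall_notMem.2 ?_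
    rintro _ ⟨⟨z, hz, rfl⟩, hz'⟩
    rw [hrot] at hz'
    exact hpos (fun n hn z hz => ne_zero_of_isSimpleRing hc h hf hA hn hz) n hn z hz hz'
  tfae_have 2 → 1 := by
    intro H
    refine isSimpleRing_cstarGenerated hc h hf fun n hn z hz hnz => ?_
    refine Set.eq_empty_iff_forall_notMem.1 (H n hn) (c ^ n * z) ⟨⟨z, hz, hrot n z⟩, hnz⟩
  tfae_have 2 → 3 := by
    rintro H ξ _ ⟨⟨m, rfl⟩, hm⟩ _ ⟨⟨n, rfl⟩, hn⟩
    by_cases hmn : m - n = 0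
    · rw [sub_eq_zero.1 hmn]
    · refine (Set.eq_empty_iff_forall_notMem.1 (H _ hmn) _ ⟨⟨_, hn, ?_⟩, hm⟩).elim
      simp only [hrot]
      rw [← mul_assoc, ← zpow_add, sub_add_cancel]
  tfae_have 3 → 4 := by
    intro H
    refine Set.eq_empty_iff_forall_notMem.2 ?_
    rintro x ⟨hx₁, hx₂⟩
    simp only [Set.mem_iUnion] at hx₁ hx₂
    obtain ⟨n, z, hz, rfl⟩ := hx₁
    obtain ⟨k, hk, w, hw, hwz⟩ := hx₂
    have hwz' : w = c ^ (k + n : ℤ) * z := by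
      rw [hrot, hrot] at hwz
      rw [zpow_add, mul_assoc, ← hwz, ← mul_assoc, ← zpow_add, add_neg_cancel, zpow_zero, one_mul]
    have := H z ⟨⟨0, by simp⟩, hz⟩ ⟨⟨(k + n : ℤ), by simp only [hrot]; exact hwz'.symm⟩, hw⟩
    rw [hwz', right_eq_mul] at this
    exact zpow_ne_one_of_denseRange_pow hc (by omega) this
  tfae_have 4 → 2 := by
    intro H n hn
    refine Set.eq_empty_iff_forall_notMem.2 ?_
    rintro _ ⟨⟨z, hz, rfl⟩, hz'⟩
    rw [hrot] at hz'
    refine hpos (fun k hk y hy hky => ?_) n hn z hz hz'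
    refine Set.eq_empty_iff_forall_notMem.1 H y ⟨?_, ?_⟩
    · exact Set.mem_iUnion.2 ⟨0, y, hy, by simp⟩
    · refine Set.mem_iUnion₂.2 ⟨k, hk, _, hky, ?_⟩
      rw [hrot, ← zpow_natCast, ← mul_assoc, ← zpow_add, neg_add_cancel, zpow_zero, one_mul]
  tfae_finish
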